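/- Let $m,n\ge 1$ be integers, let $2\le p<\infty$ and $1\le k\le \min\{m,n\}$. For a complex $m\times n$ matrix $B$ with singular values $\sigma_1(B)\ge\sigma_2(B)\ge\cdots\ge\sigma_{\min\{m,n\}}(B)\ge 0$, let $$\|B\|_{(p,k)}=\left(\sigma_1^p(B)+\sigma_2^p(B)+\cdots+\sigma_k^p(B)\right)^{1/p}$$ denote its Ky Fan $p$-$k$ norm. Let $A$ and $X$ be complex $m\times n$ matrices with $\operatorname{rank}(X)>n-k$. Then there is a unique $\alpha_0\in\mathbb{C}$ such that $$\|A-\alpha_0X\|_{(p,k)}=\min_{\alpha\in\mathbb{C}}\|A-\alpha X\|_{(p,k)}.$$ -/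

import Mathlib

/-- The `i`-th largest singular value (counted from `0`, with multiplicity) of a complex
`m × n` matrix, viewed as a linear map between the Euclidean spaces `ℂⁿ → ℂᵐ`. -/
noncomputable def matrixSingularValue {m n : ℕ} (A : Matrix (Fin m) (Fin n) ℂ) (i : ℕ) : ℝ :=
  (Matrix.toLpLin 2 2 A).singularValues i

/-- The Ky Fan `p`-`k` norm: the `ℓ_p` norm of the vector of the `k` largest singular values. -/
noncomputable def kyFanNorm {m n : ℕ} (p : ℝ) (k : ℕ) (A : Matrix (Fin m) (Fin n) ℂ) : ℝ :=
  (∑ i ∈ Finset.range k, matrixSingularValue A i ^ p) ^ (1 / p)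

section SingularValueFrames

open Module InnerProductSpace Finset

variable {E F : Type*} [NormedAddCommGroup E] [InnerProductSpace ℂ E] [FiniteDimensional ℂ E]
  [NormedAddCommGroup F] [InnerProductSpace ℂ F]

/-! For `p ≥ 2`, the sum of the `p`-th powers of the first `k` singular values of `T` is the maximum
of `∑ ‖T (u i)‖ ^ p` over orthonormal `k`-frames `u` (`exists_orthonormal_sum_norm_rpow_eq`,
`sum_norm_rpow_le`). The rank condition makes `ker X` of dimension less than `k`, so `X` kills no
such frame. The parallelogram law then gives strict midpoint convexity along `A - α X`, hence
uniqueness; existence follows from lower semicontinuity and coercivity. -/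

theorem Antitone.sum_weight_mul_le {n k : ℕ} (hkn : k ≤ n) {a : ℕ → ℝ} (ha : Antitone a)
    {c : Fin n → ℝ} (hc₀ : ∀ j, 0 ≤ c j) (hc₁ : ∀ j, c j ≤ 1) (hc : ∑ j, c j = k) :
    ∑ j, c j * a j ≤ ∑ j ∈ Finset.range k, a j := by
  have hind (f : ℕ → ℝ) : ∑ j : Fin n, (if (j : ℕ) < k then f j else 0) = ∑ j ∈ Finset.range k, f j := by
    rw [Fin.sum_univ_eq_sum_range (fun j => if j < k then f j else 0) n, ← sum_filter]
    congr 1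
    ext j
    simp only [mem_filter, Finset.mem_range]
    omega
  -- With threshold `a k`, `(c j - 1_{j<k}) * (a j - a k) ≤ 0`; the right side sums to zero.
  have hterm (j : Fin n) : c j * a j - (if (j : ℕ) < k then a j else 0)
      ≤ (c j - if (j : ℕ) < k then 1 else 0) * a k := by
    split_ifs with h
    · nlinarith [ha h.le, hc₁ j]
    · nlinarith [ha (not_lt.mp h), hc₀ j]
  have hsum := sum_le_sum fun j (_ : j ∈ univ) => hterm j
  rw [sum_sub_distrib, hind, ← sum_mul, sum_sub_distrib, hc, hind (fun _ => 1)] at hsum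
  simpa using hsum

theorem Real.sq_rpow_half {x : ℝ} (hx : 0 ≤ x) (p : ℝ) : (x ^ 2) ^ (p / 2) = x ^ p := by
  rw [← Real.rpow_natCast_mul hx]
  congr 1
  push_cast
  ring

namespace LinearMap

theorem exists_apply_ne_zero_of_orthonormal {k : ℕ} {X : E →ₗ[ℂ] F}
    (hX : finrank ℂ E < k + finrank ℂ X.range) {u : Fin k → E} (hu : Orthonormal ℂ u) :
    ∃ i, X (u i) ≠ 0 := by
  by_contra! h
  have hli : LinearIndependent ℂ (fun i => (⟨u i, h i⟩ : X.ker)) :=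
    LinearIndependent.of_comp X.ker.subtype hu.linearIndependent
  have := hli.fintype_card_le_finrank
  have := X.finrank_range_add_finrank_ker
  simp only [Fintype.card_fin] at *
  omega

/-- Parallelogram law, then convexity of `t ^ (p / 2)`. Keeping the difference term is what later
yields strictness. -/
theorem rpow_norm_midpoint_le {p : ℝ} (hp : 2 ≤ p) (x y : F) :
    (‖(2⁻¹ : ℂ) • (x + y)‖ ^ 2 + ‖(2⁻¹ : ℂ) • (x - y)‖ ^ 2) ^ (p / 2)
      ≤ (‖x‖ ^ p + ‖y‖ ^ p) / 2 := by
  have hpar : ‖(2⁻¹ : ℂ) • (x + y)‖ ^ 2 + ‖(2⁻¹ : ℂ) • (x - y)‖ ^ 2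
      = 2⁻¹ * ‖x‖ ^ 2 + 2⁻¹ * ‖y‖ ^ 2 := by
    have := parallelogram_law_with_norm ℂ x y
    simp only [norm_smul, norm_inv, Complex.norm_ofNat]
    linarith
  rw [hpar, ← Real.sq_rpow_half (norm_nonneg x), ← Real.sq_rpow_half (norm_nonneg y)]
  have := (convexOn_rpow (p := p / 2) (by linarith)).2
    (sq_nonneg ‖x‖) (sq_nonneg ‖y‖) (inv_nonneg.mpr zero_le_two) (inv_nonneg.mpr zero_le_two)
    (by norm_num)
  simp only [smul_eq_mul] at this
  linarith

variable [FiniteDimensional ℂ F]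

/-- An orthonormal basis of right singular vectors. -/
noncomputable def rightSingularBasis {n : ℕ} (hn : finrank ℂ E = n) (T : E →ₗ[ℂ] F) :
    OrthonormalBasis (Fin n) ℂ E :=
  T.isSymmetric_adjoint_comp_self.eigenvectorBasis hn

theorem sq_norm_apply_eq_sum {n : ℕ} (hn : finrank ℂ E = n) (T : E →ₗ[ℂ] F) (x : E) :
    ‖T x‖ ^ 2 = ∑ j, ‖⟪rightSingularBasis hn T j, x⟫_ℂ‖ ^ 2 * T.singularValues j ^ 2 := by
  have h : ((‖T x‖ ^ 2 : ℝ) : ℂ) = ⟪x, (adjoint T ∘ₗ T) x⟫_ℂ := by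
    rw [comp_apply, adjoint_inner_right, inner_self_eq_norm_sq_to_K]
    norm_cast
  have hj (j : Fin n) : ⟪rightSingularBasis hn T j, (adjoint T ∘ₗ T) x⟫_ℂ
      = (T.singularValues j ^ 2 : ℝ) * ⟪rightSingularBasis hn T j, x⟫_ℂ := by
    rw [T.sq_singularValues_fin hn, ← OrthonormalBasis.repr_apply_apply,
      ← OrthonormalBasis.repr_apply_apply]
    exact T.isSymmetric_adjoint_comp_self.eigenvectorBasis_apply_self_apply hn x j
  rw [← (rightSingularBasis hn T).sum_inner_mul_inner] at h
  rw [← Complex.ofReal_inj, h, Complex.ofReal_sum]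
  refine sum_congr rfl fun j _ => ?_
  rw [hj, mul_left_comm, ← inner_conj_symm x, RCLike.conj_mul, mul_comm]
  push_cast
  rfl

theorem norm_apply_rightSingularBasis {n : ℕ} (hn : finrank ℂ E = n) (T : E →ₗ[ℂ] F) (i : Fin n) :
    ‖T (rightSingularBasis hn T i)‖ = T.singularValues i := by
  rw [← sq_eq_sq₀ (norm_nonneg _) (T.singularValues_nonneg i), sq_norm_apply_eq_sum hn,
    sum_eq_single i]
  · simp
  · intro j _ hj
    simp [(rightSingularBasis hn T).inner_eq_zero hj]
  · simp

theorem exists_orthonormal_sum_norm_rpow_eq (p : ℝ) {k : ℕ} (hk : k ≤ finrank ℂ E)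
    (T : E →ₗ[ℂ] F) : ∃ u : Fin k → E, Orthonormal ℂ u ∧
      ∑ i, ‖T (u i)‖ ^ p = ∑ i ∈ Finset.range k, T.singularValues i ^ p := by
  refine ⟨fun i => rightSingularBasis rfl T (Fin.castLE hk i),
    (rightSingularBasis rfl T).orthonormal.comp _ (Fin.castLE_injective hk), ?_⟩
  simp only [norm_apply_rightSingularBasis, Fin.val_castLE]
  exact Fin.sum_univ_eq_sum_range (fun i => T.singularValues i ^ p) k

/-- Jensen with the weights `‖⟪v j, u i⟫‖ ^ 2`; summed over `i` these are at most 1 by Bessel and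
total `k`. -/
theorem sum_norm_rpow_le {p : ℝ} (hp : 2 ≤ p) {k : ℕ} (T : E →ₗ[ℂ] F) {u : Fin k → E}
    (hu : Orthonormal ℂ u) : ∑ i, ‖T (u i)‖ ^ p ≤ ∑ i ∈ Finset.range k, T.singularValues i ^ p := by
  have hk : k ≤ finrank ℂ E := by simpa using hu.linearIndependent.fintype_card_le_finrank
  set v := rightSingularBasis rfl T
  have hJ (i : Fin k) : ‖T (u i)‖ ^ p ≤ ∑ j, ‖⟪v j, u i⟫_ℂ‖ ^ 2 * T.singularValues j ^ p := by
    rw [← Real.sq_rpow_half (norm_nonneg _), sq_norm_apply_eq_sum rfl]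
    refine (Real.rpow_arith_mean_le_arith_mean_rpow _ _ _ (fun _ _ => by positivity) ?_
      (fun _ _ => by positivity) (by linarith)).trans_eq ?_
    · rw [(rightSingularBasis rfl T).sum_sq_norm_inner_right, hu.1 i, one_pow]
    · exact sum_congr rfl fun j _ => by rw [Real.sq_rpow_half (T.singularValues_nonneg j)]
  refine (sum_le_sum fun i _ => hJ i).trans ?_
  rw [sum_comm]
  simp only [← sum_mul]
  refine Antitone.sum_weight_mul_le hk (a := fun j => T.singularValues j ^ p)
    (fun i j hij => Real.rpow_le_rpow (T.singularValues_nonneg _) (T.singularValues_antitone hij)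
      (by linarith)) (fun j => by positivity) (fun j => ?_) ?_
  · simpa [norm_inner_symm, v.orthonormal.1 j] using hu.sum_inner_products_le (v j) (s := univ)
  · rw [sum_comm]
    simp [v.sum_sq_norm_inner_right, hu.1]

theorem sum_singularValues_rpow_midpoint_lt {p : ℝ} (hp : 2 ≤ p) {k : ℕ} (hk : k ≤ finrank ℂ E)
    {S T : E →ₗ[ℂ] F} (hST : finrank ℂ E < k + finrank ℂ (S - T).range) :
    ∑ i ∈ Finset.range k, ((2⁻¹ : ℂ) • (S + T)).singularValues i ^ p
      < (∑ i ∈ Finset.range k, S.singularValues i ^ p + ∑ i ∈ Finset.range k, T.singularValues i ^ p) / 2 := by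
  -- A frame optimal for the midpoint is merely admissible for `S` and `T`.
  obtain ⟨u, hu, hsum⟩ := exists_orthonormal_sum_norm_rpow_eq p hk ((2⁻¹ : ℂ) • (S + T))
  obtain ⟨i₀, hi₀⟩ := exists_apply_ne_zero_of_orthonormal hST hu
  have hle (i : Fin k) := rpow_norm_midpoint_le hp (S (u i)) (T (u i))
  calc _ = ∑ i, ‖(2⁻¹ : ℂ) • (S (u i) + T (u i))‖ ^ p := by rw [← hsum]; rfl
    _ < ∑ i, (‖S (u i)‖ ^ p + ‖T (u i)‖ ^ p) / 2 := by
      refine sum_lt_sum (fun i _ => le_trans ?_ (hle i)) ⟨i₀, mem_univ _, lt_of_lt_of_le ?_ (hle i₀)⟩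
      · rw [← Real.sq_rpow_half (norm_nonneg _)]
        gcongr
        simp
      · rw [← Real.sq_rpow_half (norm_nonneg _)]
        refine Real.rpow_lt_rpow (sq_nonneg _) ?_ (by linarith)
        have : 0 < ‖(2⁻¹ : ℂ) • (S (u i₀) - T (u i₀))‖ := by
          rw [norm_pos_iff]
          exact smul_ne_zero (by norm_num) hi₀
        nlinarith
    _ = (∑ i, ‖S (u i)‖ ^ p + ∑ i, ‖T (u i)‖ ^ p) / 2 := by
      rw [← sum_div, sum_add_distrib]
    _ ≤ _ := by
      have := sum_norm_rpow_le hp S hu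
      have := sum_norm_rpow_le hp T hu
      linarith

/-- A frame optimal at `α` gives a continuous minorant touching there. -/
theorem lowerSemicontinuous_sum_singularValues_rpow {p : ℝ} (hp : 2 ≤ p) {k : ℕ}
    (hk : k ≤ finrank ℂ E) (S X : E →ₗ[ℂ] F) :
    LowerSemicontinuous fun α : ℂ => ∑ i ∈ Finset.range k, (S - α • X).singularValues i ^ p := by
  intro α c hc
  obtain ⟨u, hu, hsum⟩ := exists_orthonormal_sum_norm_rpow_eq p hk (S - α • X)
  have hcont : Continuous fun β : ℂ => ∑ i, ‖(S - β • X) (u i)‖ ^ p := by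
    refine continuous_finsetSum _ fun i _ => Continuous.rpow_const ?_ fun _ => Or.inr (by linarith)
    simp only [sub_apply, smul_apply]
    fun_prop
  dsimp only at hc
  rw [← hsum] at hc
  filter_upwards [hcont.continuousAt.eventually_const_lt hc] with β hβ
  exact hβ.trans_le (sum_norm_rpow_le hp _ hu)

theorem exists_forall_sum_singularValues_rpow_le {p : ℝ} (hp : 2 ≤ p) {k : ℕ}
    (hk : k ≤ finrank ℂ E) (S : E →ₗ[ℂ] F) {X : E →ₗ[ℂ] F}
    (hX : finrank ℂ E < k + finrank ℂ X.range) :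
    ∃ α₀ : ℂ, ∀ α : ℂ, ∑ i ∈ Finset.range k, (S - α₀ • X).singularValues i ^ p
      ≤ ∑ i ∈ Finset.range k, (S - α • X).singularValues i ^ p := by
  obtain ⟨u, hu, -⟩ := exists_orthonormal_sum_norm_rpow_eq p hk X
  obtain ⟨i₀, hi₀⟩ := exists_apply_ne_zero_of_orthonormal hX hu
  have hpos : 0 < ‖X (u i₀)‖ := norm_pos_iff.mpr hi₀
  set g := fun α : ℂ => ∑ i ∈ Finset.range k, (S - α • X).singularValues i ^ p with hg
  have hg₀ (α : ℂ) : 0 ≤ g α :=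
    sum_nonneg fun i _ => Real.rpow_nonneg (singularValues_nonneg _ i) _
  have hp₀ : 0 < p := by linarith
  -- Beyond radius `R`, the single vector `u i₀` already forces `g α ≥ g 0`.
  set R := (g 0 ^ (1 / p) + ‖S (u i₀)‖) / ‖X (u i₀)‖ with hR
  have hR₀ : 0 ≤ R := by
    have := Real.rpow_nonneg (hg₀ 0) (1 / p)
    positivity
  obtain ⟨α₀, -, hmin⟩ := LowerSemicontinuousOn.exists_isMinOn
    (s := Metric.closedBall (0 : ℂ) R) ⟨0, by simpa using hR₀⟩ (isCompact_closedBall _ _)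
    ((lowerSemicontinuous_sum_singularValues_rpow hp hk S X).lowerSemicontinuousOn _)
  refine ⟨α₀, fun α => ?_⟩
  by_cases hα : α ∈ Metric.closedBall (0 : ℂ) R
  · exact hmin hα
  refine (hmin (by simpa using hR₀ : (0 : ℂ) ∈ Metric.closedBall (0 : ℂ) R)).trans ?_
  rw [mem_closedBall_zero_iff, not_le, hR, div_lt_iff₀ hpos] at hα
  have hnorm : g 0 ^ (1 / p) ≤ ‖(S - α • X) (u i₀)‖ := by
    have := norm_sub_norm_le (α • X (u i₀)) (S (u i₀))
    rw [norm_smul, norm_sub_rev] at this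
    exact (by linarith : g 0 ^ (1 / p) ≤ ‖S (u i₀) - α • X (u i₀)‖)
  calc g 0 = (g 0 ^ (1 / p)) ^ p := by
        rw [← Real.rpow_mul (hg₀ 0), one_div_mul_cancel hp₀.ne', Real.rpow_one]
    _ ≤ ‖(S - α • X) (u i₀)‖ ^ p :=
      Real.rpow_le_rpow (Real.rpow_nonneg (hg₀ 0) _) hnorm hp₀.le
    _ ≤ ∑ i, ‖(S - α • X) (u i)‖ ^ p :=
      single_le_sum (f := fun i => ‖(S - α • X) (u i)‖ ^ p) (fun i _ => by positivity) (mem_univ i₀)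
    _ ≤ g α := sum_norm_rpow_le hp _ hu

theorem existsUnique_forall_sum_singularValues_rpow_le {p : ℝ} (hp : 2 ≤ p) {k : ℕ}
    (hk : k ≤ finrank ℂ E) (S : E →ₗ[ℂ] F) {X : E →ₗ[ℂ] F}
    (hX : finrank ℂ E < k + finrank ℂ X.range) :
    ∃! α₀ : ℂ, ∀ α : ℂ, ∑ i ∈ Finset.range k, (S - α₀ • X).singularValues i ^ p
      ≤ ∑ i ∈ Finset.range k, (S - α • X).singularValues i ^ p := by
  obtain ⟨α₀, h₀⟩ := exists_forall_sum_singularValues_rpow_le hp hk S hX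
  refine ⟨α₀, h₀, fun β hβ => ?_⟩
  by_contra hne
  have hdiff : S - α₀ • X - (S - β • X) = (β - α₀) • X := by module
  have hlt := sum_singularValues_rpow_midpoint_lt (S := S - α₀ • X) (T := S - β • X) hp hk
    (by rwa [hdiff, range_smul _ _ (sub_ne_zero.mpr hne)])
  have hmid : (2⁻¹ : ℂ) • (S - α₀ • X + (S - β • X)) = S - (2⁻¹ * (α₀ + β)) • X := by module
  rw [hmid] at hlt
  have := h₀ (2⁻¹ * (α₀ + β))
  have := hβ (2⁻¹ * (α₀ + β))
  linarith

end LinearMap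

end SingularValueFrames

theorem kyFanNorm_le_kyFanNorm_iff {m n : ℕ} {p : ℝ} (hp : 0 < p) {k : ℕ}
    {A B : Matrix (Fin m) (Fin n) ℂ} :
    kyFanNorm p k A ≤ kyFanNorm p k B ↔
      ∑ i ∈ Finset.range k, (Matrix.toLpLin 2 2 A).singularValues i ^ p
        ≤ ∑ i ∈ Finset.range k, (Matrix.toLpLin 2 2 B).singularValues i ^ p :=
  Real.rpow_le_rpow_iff
    (Finset.sum_nonneg fun i _ => Real.rpow_nonneg (LinearMap.singularValues_nonneg _ i) _)
    (Finset.sum_nonneg fun i _ => Real.rpow_nonneg (LinearMap.singularValues_nonneg _ i) _)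
    (by positivity)

theorem mainTheorem3 {m n k : ℕ} (hk : 1 ≤ k) (hkmn : k ≤ min m n) (p : ℝ) (hp : 2 ≤ p)
    (A X : Matrix (Fin m) (Fin n) ℂ) (hX : n - k < X.rank) :
    ∃! α₀ : ℂ, IsLeast (Set.range fun α : ℂ => kyFanNorm p k (A - α • X))
      (kyFanNorm p k (A - α₀ • X)) := by
  have hn : Module.finrank ℂ (WithLp 2 (Fin n → ℂ)) = n := finrank_euclideanSpace_fin
  have hrank : X.rank = Module.finrank ℂ (Matrix.toLpLin 2 2 X).range := by
    rw [Matrix.toLpLin_eq_toLin]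
    exact X.rank_eq_finrank_range_toLin _ _
  have hiff (α₀ : ℂ) : IsLeast (Set.range fun α : ℂ => kyFanNorm p k (A - α • X))
      (kyFanNorm p k (A - α₀ • X)) ↔ ∀ α : ℂ,
      ∑ i ∈ Finset.range k,
        (Matrix.toLpLin 2 2 A - α₀ • Matrix.toLpLin 2 2 X).singularValues i ^ p
        ≤ ∑ i ∈ Finset.range k,
          (Matrix.toLpLin 2 2 A - α • Matrix.toLpLin 2 2 X).singularValues i ^ p := by
    simp only [IsLeast, Set.mem_range_self, true_and, mem_lowerBounds, Set.forall_mem_range,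
      kyFanNorm_le_kyFanNorm_iff (by linarith : 0 < p), map_sub, map_smul]
  simp only [hiff]
  -- Since `k ≤ n`, the natural subtraction in `hX` is not truncated.
  exact LinearMap.existsUnique_forall_sum_singularValues_rpow_le hp (by omega) _ (by omega)
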